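/- Let $X,Y,Z$ be real locally convex Hausdorff topological vector spaces, let $K\subset Y$ be a closed convex cone with $K\neq Y$ and $\operatorname{int}K\neq\emptyset$, and let $S\subset Z$ be a non-empty convex cone. Write $\mathcal L(X,Y)$ for the space of continuous linear maps from $X$ to $Y$, and $Y^\infty=Y\cup\{+\infty_Y\}$, $Y^\bullet=Y\cup\{-\infty_Y,+\infty_Y\}$, with the conventions $y+(\pm\infty_Y)=\pm\infty_Y$ for $y\in Y$ and $-(+\infty_Y)=-\infty_Y$. For $y_1,y_2\in Y$ put $y_1\leqq_K y_2$ iff $y_1-y_2\in -K$, and $y_1<_K y_2$ iff $y_1-y_2\in-\operatorname{int}K$; both relations are extended so that $+\infty_Y$ is the greatest and $-\infty_Y$ the smallest element (so $-\infty_Y<_K y<_K+\infty_Y$ for $y\in Y$). For $M\subset Y^\bullet$, $\operatorname{WSup}M$ is the set of all $v\in Y^\bullet$ such that $v\not<_K u$ for every $u\in M$ and such that every $w\in Y^\bullet$ with $w<_K v$ satisfies $w<_K u$ for some $u\in M$. For $F\colon X\to Y^\infty$ put $\operatorname{dom}F=\{x: F(x)\neq+\infty_Y\}$, $\operatorname{epi}F=\{(x,y)\in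 X\times Y: y\in F(x)+K\}$, and, for $L\in\mathcal L(X,Y)$, $F^*(L)=\operatorname{WSup}\{L(x)-F(x):x\in X\}$; for a set-valued map $G\colon\mathcal L(X,Y)\rightrightarrows Y^\bullet$ put $\operatorname{epi}G=\{(L,y)\in\mathcal L(X,Y)\times Y: y\in G(L)+K\}$. Let $\Phi\colon X\times Z\to Y^\infty$ be $K$-convex (that is, $\operatorname{epi}\Phi$ is convex), let $\pi(x,z)=z$, assume $0_Z\in\pi(\operatorname{dom}\Phi)$ (so $\Phi$ is proper), and let $Z_0=\operatorname{lin}(\pi(\operatorname{dom}\Phi))$ carry the topology induced by $Z$. For $L\in\mathcal L(X,Y)$ and $T\in\mathcal L(Z,Y)$ put $\Phi^*(L,T)=\operatorname{WSup}\{L(x)+T(z)-\Phi(x,z):(x,z)\in X\times Z\}$. Let $$\mathcal L_\Phi=\{T\in\mathcal L(Z,Y):\exists L\in\mathcal L(X,Y),\ \Phi^*(L,T)\neq\{+\infty_Y\}\},\qquad \mathcal L_\Phi^+=\{T\in\mathcal L_\Phi: T(S)\subset K\},$$ $$\mathcal M=\bigcup_{T\in\mathcal L_\Phi}\operatorname{epi}\Phi^*(\cdot,T),\qquad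 \mathcal M_+=\bigcup_{T\in\mathcal L_\Phi^+}\operatorname{epi}\Phi^*(\cdot,T).$$ For a set $U\subset Z$, let $\operatorname{ri}U$ be the interior of $U$ relative to its affine hull $\operatorname{aff}U$, and let $\operatorname{icr}U$ be the set of all $u\in U$ such that for every $u'\in\operatorname{aff}U$ there is $\delta>0$ with $u+\lambda(u'-u)\in U$ for all $\lambda\in[0,\delta]$. Consider the following conditions. - $(C_0)$ There is $\tilde x\in X$ with $(\tilde x,0_Z)\in\operatorname{dom}\Phi$ and $\Phi(\tilde x,z)\leqq_K\Phi(\tilde x,0_Z)$ for all $z\in-S$. - $(C_2)$ There are $(\hat x,\hat y)\in X\times Y$ and a neighbourhood $\hat V$ of $0_Z$ in $Z$ such that $\Phi(\hat x,z)\leqq_K\hat y$ for all $z\in\hat V\cap Z_0$. - $(C_3)$ There is $\hat x\in X$ with $(\hat x,0_Z)\in\operatorname{dom}\Phi$ such that the restriction of $\Phi(\hat x,\cdot)$ to $Z_0$ is continuous at $0_Z$ (every neighbourhood of $\Phi(\hat x,0_Z)$ in $Y$ contains $\Phi(\hat x,z)$ for all $z\in Z_0$ close enough to $0_Z$). - $(C_4)$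 $\dim Z_0<\infty$ and $0_Z\in\operatorname{ri}(\pi(\operatorname{dom}\Phi))$. - $(C_5)$ $X$ and $Y$ are complete and first countable, $Z_0$ is barrelled, $\operatorname{epi}\Phi$ is closed in $X\times Z\times Y$, and $0_Z\in\operatorname{icr}(\pi(\operatorname{dom}\Phi))$. - $(C_6)$ $\Phi(x,0_Z)\leqq_K\Phi(x,z)$ for all $(x,z)\in\operatorname{dom}\Phi$, and $\operatorname{int}(\pi(\operatorname{dom}\Phi))\neq\emptyset$. **Theorem (second representation of $\operatorname{epi}\Phi(\cdot,0_Z)^*$).** If at least one of $(C_2)$, $(C_3)$, $(C_4)$, $(C_5)$, $(C_6)$ holds, then $$\operatorname{epi}\Phi(\cdot,0_Z)^*=\mathcal M .$$ If, in addition, $(C_0)$ holds, then $$\operatorname{epi}\Phi(\cdot,0_Z)^*=\mathcal M=\mathcal M_+ .$$ -/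

import Mathlib

open Topology Pointwise

namespace VectorPerturbation

section Order

variable {Y : Type*} [AddCommGroup Y] [Module ℝ Y]

/-- `Y^•`: the space `Y` with a smallest element `⊥` (that is `-∞_Y`) and a greatest element
(the image of `⊤ : WithTop Y`, that is `+∞_Y`) attached; `WithTop Y` is `Y^∞`.
Sums are those of `WithTop` and `WithBot`: `y + (+∞) = +∞` and `y + (-∞) = -∞` for `y ∈ Y`. -/
abbrev Ext (Y : Type*) := WithBot (WithTop Y)

/-- The element `+∞_Y` of `Y^•`. -/
def posInf : Ext Y := ((⊤ : WithTop Y) : Ext Y)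

/-- The element `-∞_Y` of `Y^•`. -/
def negInf : Ext Y := ⊥

/-- The inclusion of `Y` in `Y^•`. -/
def fin (y : Y) : Ext Y := ((y : WithTop Y) : Ext Y)

/-- The map `v ↦ -v` from `Y^∞` to `Y^•`, with `-(+∞_Y) = -∞_Y`. -/
def extNeg : WithTop Y → Ext Y
  | ⊤ => negInf
  | (y : Y) => fin (-y)

/-- The ordering `≦_K` on `Y^∞`: `y₁ ≦_K y₂` iff `y₁ - y₂ ∈ -K` for `y₁, y₂ ∈ Y`, and
`+∞_Y` is the greatest element. -/
def LeK (K : ConvexCone ℝ Y) (a b : WithTop Y) : Prop :=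
  b = ⊤ ∨ ∃ y₁ y₂ : Y, a = (y₁ : WithTop Y) ∧ b = (y₂ : WithTop Y) ∧ y₁ - y₂ ∈ -(K : Set Y)

variable [TopologicalSpace Y]

/-- The weak ordering `<_K` on `Y^•`: `y₁ <_K y₂` iff `y₁ - y₂ ∈ -int K` for `y₁, y₂ ∈ Y`, and
`-∞_Y <_K y <_K +∞_Y`, `-∞_Y <_K +∞_Y`. -/
def LtK (K : ConvexCone ℝ Y) (a b : Ext Y) : Prop :=
  (a = negInf ∧ b ≠ negInf) ∨ (a ≠ posInf ∧ b = posInf) ∨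
    ∃ y₁ y₂ : Y, a = fin y₁ ∧ b = fin y₂ ∧ y₁ - y₂ ∈ -interior (K : Set Y)

/-- The weak supremum `WSup M` of `M ⊆ Y^•`. -/
def WSup (K : ConvexCone ℝ Y) (M : Set (Ext Y)) : Set (Ext Y) :=
  {v | (∀ u ∈ M, ¬ LtK K v u) ∧ ∀ w : Ext Y, LtK K w v → ∃ u ∈ M, LtK K w u}

end Order

section Mappings

variable {X Y : Type*} [AddCommGroup Y] [Module ℝ Y]

/-- The domain of `F : X → Y^∞`. -/
def effDom (F : X → WithTop Y) : Set X := {x | F x ≠ ⊤}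

/-- The `K`-epigraph of `F : X → Y^∞`, the set of `(x, y) ∈ X × Y` with `y ∈ F x + K`. -/
def epiK (K : ConvexCone ℝ Y) (F : X → WithTop Y) : Set (X × Y) :=
  {p | ∃ k ∈ K, (p.2 : WithTop Y) = F p.1 + (k : WithTop Y)}

variable [TopologicalSpace Y] [AddCommGroup X] [Module ℝ X] [TopologicalSpace X]

/-- The conjugate `F^*(L) = WSup {L x - F x : x ∈ X}`. -/
def conj (K : ConvexCone ℝ Y) (F : X → WithTop Y) (L : X →L[ℝ] Y) : Set (Ext Y) :=
  WSup K (Set.range fun x => fin (L x) + extNeg (F x))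

/-- The `K`-epigraph of a set-valued mapping `G : 𝓛(X, Y) ⇉ Y^•`, the set of
`(L, y) ∈ 𝓛(X, Y) × Y` with `y ∈ G L + K`. -/
def epiSet (K : ConvexCone ℝ Y) (G : (X →L[ℝ] Y) → Set (Ext Y)) : Set ((X →L[ℝ] Y) × Y) :=
  {p | fin p.2 ∈ G p.1 + fin '' (K : Set Y)}

end Mappings

section IntrinsicCore

variable {E : Type*} [AddCommGroup E] [Module ℝ E]

/-- The intrinsic core of `U`: the points of `U` from which one can move a little, inside `U`,
towards any point of the affine hull of `U`. -/
def intrinsicCore (U : Set E) : Set E :=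
  {x | x ∈ U ∧ ∀ x' ∈ affineSpan ℝ U, ∃ δ > (0 : ℝ), ∀ t ∈ Set.Icc 0 δ, x + t • (x' - x) ∈ U}

end IntrinsicCore

section Perturbation

variable {X Y Z : Type*}
  [AddCommGroup X] [Module ℝ X] [UniformSpace X]
  [AddCommGroup Y] [Module ℝ Y] [UniformSpace Y]
  [AddCommGroup Z] [Module ℝ Z] [TopologicalSpace Z]

/-- `π(dom Φ)`, the projection of `dom Φ` on `Z`. -/
def projDom (Φ : X × Z → WithTop Y) : Set Z := Prod.snd '' effDom Φ

/-- `Z₀ = lin (π(dom Φ))`, with the topology induced by `Z`. -/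
def Z0 (Φ : X × Z → WithTop Y) : Submodule ℝ Z := Submodule.span ℝ (projDom Φ)

/-- The conjugate `Φ^* : 𝓛(X, Y) × 𝓛(Z, Y) ⇉ Y^•`, where `(L, T)` stands for the operator
`(x, z) ↦ L x + T z` on `X × Z`. -/
def conj₂ (K : ConvexCone ℝ Y) [IsUniformAddGroup Y] (Φ : X × Z → WithTop Y)
    (L : X →L[ℝ] Y) (T : Z →L[ℝ] Y) : Set (Ext Y) :=
  conj K Φ (L.coprod T)

/-- `𝓛_Φ`, the projection of `dom Φ^*` on `𝓛(Z, Y)`. -/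
def opsPhi (K : ConvexCone ℝ Y) [IsUniformAddGroup Y] (Φ : X × Z → WithTop Y) :
    Set (Z →L[ℝ] Y) :=
  {T | ∃ L : X →L[ℝ] Y, conj₂ K Φ L T ≠ {posInf}}

/-- `𝓛_+(S, K)`, the cone of positive operators. -/
def posOps (S : ConvexCone ℝ Z) (K : ConvexCone ℝ Y) : Set (Z →L[ℝ] Y) :=
  {T | ∀ s ∈ S, T s ∈ K}

/-- `𝓜 = ⋃ epi Φ^*(·, T)`, the union over `T ∈ 𝓛_Φ`. -/
def setM (K : ConvexCone ℝ Y) [IsUniformAddGroup Y] (Φ : X × Z → WithTop Y) :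
    Set ((X →L[ℝ] Y) × Y) :=
  ⋃ T ∈ opsPhi K Φ, epiSet K fun L => conj₂ K Φ L T

/-- `𝓜_+ = ⋃ epi Φ^*(·, T)`, the union over `T ∈ 𝓛_Φ ∩ 𝓛_+(S, K)`. -/
def setMPos (S : ConvexCone ℝ Z) (K : ConvexCone ℝ Y) [IsUniformAddGroup Y]
    (Φ : X × Z → WithTop Y) : Set ((X →L[ℝ] Y) × Y) :=
  ⋃ T ∈ opsPhi K Φ ∩ posOps S K, epiSet K fun L => conj₂ K Φ L T

def C0 (S : ConvexCone ℝ Z) (K : ConvexCone ℝ Y) (Φ : X × Z → WithTop Y) : Prop :=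
  ∃ x : X, (x, 0) ∈ effDom Φ ∧ ∀ z ∈ -(S : Set Z), LeK K (Φ (x, z)) (Φ (x, 0))

def C2 (K : ConvexCone ℝ Y) (Φ : X × Z → WithTop Y) : Prop :=
  ∃ (x : X) (y : Y), ∃ V ∈ 𝓝 (0 : Z), ∀ z ∈ V ∩ (Z0 Φ : Set Z), LeK K (Φ (x, z)) (y : WithTop Y)

/-- For some `x` with `Φ(x, 0) = y₀ ∈ Y`, the restriction of `Φ(x, ·)` to `Z₀` is continuous
at `0`: every neighbourhood of `y₀` in `Y` contains `Φ(x, z)` for all `z ∈ Z₀` near `0`. -/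
def C3 (Φ : X × Z → WithTop Y) : Prop :=
  ∃ (x : X) (y₀ : Y), Φ (x, 0) = (y₀ : WithTop Y) ∧
    Filter.Tendsto (fun z : Z0 Φ => Φ (x, (z : Z))) (𝓝 0)
      (Filter.map (fun y : Y => (y : WithTop Y)) (𝓝 y₀))

/-- `intrinsicInterior` is the relative interior. -/
def C4 (Φ : X × Z → WithTop Y) : Prop :=
  FiniteDimensional ℝ (Z0 Φ) ∧ (0 : Z) ∈ intrinsicInterior ℝ (projDom Φ)

def C5 (K : ConvexCone ℝ Y) (Φ : X × Z → WithTop Y) : Prop :=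
  CompleteSpace X ∧ FirstCountableTopology X ∧ CompleteSpace Y ∧ FirstCountableTopology Y ∧
    BarrelledSpace ℝ (Z0 Φ) ∧ IsClosed (epiK K Φ) ∧ (0 : Z) ∈ intrinsicCore (projDom Φ)

def C6 (K : ConvexCone ℝ Y) (Φ : X × Z → WithTop Y) : Prop :=
  (∀ (x : X) (z : Z), (x, z) ∈ effDom Φ → LeK K (Φ (x, 0)) (Φ (x, z))) ∧
    (interior (projDom Φ)).Nonempty

end Perturbation

end VectorPerturbation

/-!
The epigraph of the conjugate of a `K`-convex mapping `F` consists of the pairs `(L, y)` for which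
no `L x - y' - y`, with `(x, y')` in the epigraph of `F`, is interior to `K`
(`mem_epiSet_conj_iff`, from the description of finite weak suprema in `fin_mem_wSup_add_iff`).
Restricting this description of `Φ^*(L, T)` to `z = 0` shows that `𝓜` is contained in the epigraph
of `Φ(·, 0)^*`.

For the converse, let `(L, y)` lie in the epigraph of `Φ(·, 0)^*`. The points `L x - y' - y` with
`((x, 0), y')` in the epigraph of `Φ` form a convex set that misses the interior of `K`, so a
functional `f` on `Y` which is positive on that interior is nonpositive on them
(`exists_pos_functional`). The affine functional `(x, y') ↦ f (y' + y - L x)` is therefore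
nonnegative on the epigraph over `z = 0`, and what is needed is a subgradient at `0` of the scalar
convex value function `z ↦ inf f (y' + y - L x)`: a continuous functional `l` of `z` that minorizes
it (`exists_continuous_minorant`). With `k` interior to `K` and `f k = 1`, the rank-one operator
`T z = l z • k` then satisfies `f (L x + T z - y' - y) ≤ 0` on the epigraph of `Φ`, so that `(L, y)`
belongs to the epigraph of `Φ^*(·, T)`. Under `C0` the same inequality along the ray `-t • s`
forces `l s ≥ 0` for `s ∈ S`, hence `T s ∈ K` (`nonneg_of_C0`).

The subgradient exists algebraically on `Z₀` as soon as `π(dom Φ)` absorbs `Z₀`, by the Riesz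
extension theorem (`exists_linear_minorant`). It is continuous if `Z₀` is finite-dimensional, which
settles `C4`, or if the value function is bounded above near `0`. The latter is immediate under
`C2`, and `C3` implies `C2`. Under `C5` it follows from an open mapping theorem for closed convex
relations into a barrelled space (`eventually_exists_mem_of_barrelled`). The Hahn–Banach theorem
extends the functional from `Z₀` to `Z`. Under `C6` the functional `0` is a subgradient.
-/

namespace VectorPerturbation

/-! ### Cones with nonempty interior -/

section ConeInterior

variable {Y : Type*} [AddCommGroup Y] [Module ℝ Y] [TopologicalSpace Y] {K : ConvexCone ℝ Y}

theorem smul_mem_interior_cone [ContinuousConstSMul ℝ Y] {t : ℝ} (ht : 0 < t) {a : Y}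
    (ha : a ∈ interior (K : Set Y)) : t • a ∈ interior (K : Set Y) := by
  have h : interior (t • (K : Set Y)) ⊆ interior (K : Set Y) := interior_mono <| by
    rintro _ ⟨b, hb, rfl⟩
    exact K.smul_mem ht hb
  rw [interior_smul₀ ht.ne'] at h
  exact h (Set.smul_mem_smul_set ha)

theorem add_mem_interior_cone [IsTopologicalAddGroup Y] {a k : Y}
    (ha : a ∈ interior (K : Set Y)) (hk : k ∈ K) : a + k ∈ interior (K : Set Y) := by
  have h : interior (K : Set Y) + (K : Set Y) ⊆ interior (K : Set Y) :=
    subset_interior_add_left.trans <| interior_mono <| by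
      rintro _ ⟨a, ha, b, hb, rfl⟩
      exact K.add_mem ha hb
  exact h (Set.add_mem_add ha hk)

/-- An interior point of `K` stays in the interior under small displacements in any direction. -/
theorem exists_add_smul_mem_interior_cone [IsTopologicalAddGroup Y] [ContinuousSMul ℝ Y] {a : Y}
    (ha : a ∈ interior (K : Set Y)) (v : Y) :
    ∃ ε > (0 : ℝ), a + ε • v ∈ interior (K : Set Y) := by
  have hc : Filter.Tendsto (fun ε : ℝ => a + ε • v) (𝓝[>] 0) (𝓝 a) := by
    have : Continuous fun ε : ℝ => a + ε • v := by fun_prop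
    simpa using (this.tendsto 0).mono_left nhdsWithin_le_nhds
  obtain ⟨ε, hε, hpos⟩ :=
    ((hc.eventually (isOpen_interior.mem_nhds ha)).and self_mem_nhdsWithin).exists
  exact ⟨ε, hpos, hε⟩

theorem zero_mem_cone [ContinuousSMul ℝ Y] (hKclosed : IsClosed (K : Set Y)) {k : Y}
    (hk : k ∈ K) : (0 : Y) ∈ K := by
  have hc : Filter.Tendsto (fun t : ℝ => t • k) (𝓝[>] 0) (𝓝 0) := by
    have : Continuous fun t : ℝ => t • k := by fun_prop
    simpa using (this.tendsto 0).mono_left nhdsWithin_le_nhds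
  refine hKclosed.mem_of_tendsto hc ?_
  filter_upwards [self_mem_nhdsWithin] with t ht
  exact K.smul_mem ht hk

end ConeInterior

/-! ### Weak suprema -/

section Ext

variable {Y : Type*}

theorem fin_injective : Function.Injective (fin : Y → Ext Y) := fun a b h => by
  simpa [fin] using h

theorem fin_ne_posInf (a : Y) : fin a ≠ posInf := by simp [fin, posInf]

theorem fin_ne_negInf (a : Y) : fin a ≠ negInf := by simp [fin, negInf]

theorem posInf_ne_negInf : (posInf : Ext Y) ≠ negInf := by simp [posInf, negInf]

theorem ext_cases (v : Ext Y) : v = negInf ∨ v = posInf ∨ ∃ a, v = fin a := by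
  by_cases hbot : v = ⊥
  · exact .inl hbot
  obtain ⟨w, rfl⟩ := WithBot.ne_bot_iff_exists.1 hbot
  by_cases htop : w = ⊤
  · exact .inr (.inl (htop ▸ rfl))
  · obtain ⟨a, rfl⟩ := WithTop.ne_top_iff_exists.1 htop
    exact .inr (.inr ⟨a, rfl⟩)

variable [AddCommGroup Y]

theorem fin_add_fin (a b : Y) : fin a + fin b = fin (a + b) := by
  simp [fin]

theorem fin_add_extNeg_top (a : Y) : fin a + extNeg (⊤ : WithTop Y) = negInf := by
  simp [extNeg, negInf]

theorem fin_add_extNeg_coe (a g : Y) : fin a + extNeg (g : WithTop Y) = fin (a - g) := by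
  rw [sub_eq_add_neg, ← fin_add_fin]
  rfl

end Ext

section WeakSup

variable {Y : Type*} [AddCommGroup Y] [Module ℝ Y] [TopologicalSpace Y] {K : ConvexCone ℝ Y}

theorem ltK_fin_fin {a b : Y} : LtK K (fin a) (fin b) ↔ b - a ∈ interior (K : Set Y) := by
  constructor
  · rintro (⟨h, -⟩ | ⟨-, h⟩ | ⟨y₁, y₂, h₁, h₂, h⟩)
    · exact (fin_ne_negInf _ h).elim
    · exact (fin_ne_posInf _ h).elim
    · rw [fin_injective h₁, fin_injective h₂]
      simpa using h
  · intro h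
    exact .inr (.inr ⟨a, b, rfl, rfl, by simpa using h⟩)

theorem negInf_ltK_fin (a : Y) : LtK K negInf (fin a) := .inl ⟨rfl, fin_ne_negInf a⟩

theorem not_ltK_negInf (a : Ext Y) : ¬ LtK K a negInf := by
  rintro (⟨-, h⟩ | ⟨-, h⟩ | ⟨y₁, y₂, -, h, -⟩)
  · exact h rfl
  · exact posInf_ne_negInf h.symm
  · exact fin_ne_negInf _ h.symm

theorem not_posInf_ltK (a : Ext Y) : ¬ LtK K posInf a := by
  rintro (⟨h, -⟩ | ⟨h, -⟩ | ⟨y₁, y₂, h, -, -⟩)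
  · exact posInf_ne_negInf h
  · exact h rfl
  · exact fin_ne_posInf _ h.symm

omit [TopologicalSpace Y] in
theorem mem_add_image_fin_iff {A : Set (Ext Y)} {y : Y} :
    fin y ∈ A + fin '' (K : Set Y) ↔ ∃ v, fin v ∈ A ∧ y - v ∈ K := by
  constructor
  · rintro ⟨a, ha, _, ⟨k, hk, rfl⟩, h⟩
    rcases ext_cases a with rfl | rfl | ⟨v, rfl⟩
    · exact (fin_ne_negInf y (by simpa [negInf] using h.symm)).elim
    · refine (fin_ne_posInf y ?_).elim
      exact h.symm.trans rfl
    · simp only [fin_add_fin] at h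
      rw [← fin_injective h]
      exact ⟨v, ha, by simpa using hk⟩
  · rintro ⟨v, hv, hk⟩
    exact ⟨fin v, hv, fin (y - v), ⟨_, hk, rfl⟩, by simp [fin_add_fin]⟩

/-- The sums `y + k` with `y` a finite weak supremum and `k ∈ K` are exactly the points that are
not weakly below any element. The nontrivial inclusion descends from such a point along an
interior direction of `K` to the last point with this property; that point is a weak
supremum. -/
theorem fin_mem_wSup_add_iff [IsTopologicalAddGroup Y] [ContinuousSMul ℝ Y]
    (hKclosed : IsClosed (K : Set Y))
    (hKint : (interior (K : Set Y)).Nonempty) {M : Set (Ext Y)} {u₀ : Y} (hu₀ : fin u₀ ∈ M)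
    (htop : posInf ∉ M) {y : Y} :
    fin y ∈ WSup K M + fin '' (K : Set Y) ↔
      ∀ u, fin u ∈ M → u - y ∉ interior (K : Set Y) := by
  rw [mem_add_image_fin_iff]
  constructor
  · rintro ⟨v, ⟨hv, -⟩, hk⟩ u hu h
    refine hv _ hu (ltK_fin_fin.2 ?_)
    simpa using add_mem_interior_cone h hk
  · intro h
    obtain ⟨k, hk⟩ := hKint
    set s : Set ℝ := {t | 0 ≤ t ∧ ∀ u, fin u ∈ M → u - (y - t • k) ∉ interior (K : Set Y)}
      with hs
    have h0 : (0 : ℝ) ∈ s := ⟨le_rfl, by simpa using h⟩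
    -- `s` is an interval: from `t ∈ s` the defining property passes down to every `t' < t`.
    have hmono : ∀ t ∈ s, ∀ t' < t, ∀ u, fin u ∈ M →
        u - (y - t' • k) ∉ interior (K : Set Y) := by
      rintro t ⟨-, ht⟩ t' htt u hu h'
      refine ht u hu ?_
      have := add_mem_interior_cone h' (K.smul_mem (sub_pos.2 htt) (interior_subset hk))
      rwa [sub_smul, show u - (y - t' • k) + (t • k - t' • k) = u - (y - t • k) by abel] at this
    have hbdd : BddAbove s := by
      obtain ⟨ε, hε, hk'⟩ := exists_add_smul_mem_interior_cone hk (u₀ - y)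
      refine ⟨ε⁻¹, fun t ht => ?_⟩
      by_contra! hlt
      refine hmono t ht _ hlt u₀ hu₀ ?_
      have := smul_mem_interior_cone (inv_pos.2 hε) hk'
      rw [smul_add, smul_smul, inv_mul_cancel₀ hε.ne', one_smul] at this
      rwa [show u₀ - (y - ε⁻¹ • k) = ε⁻¹ • k + (u₀ - y) by abel]
    have hclosed : IsClosed s := by
      have : s = Set.Ici 0 ∩ ⋂ u ∈ {u | fin u ∈ M},
          (fun t : ℝ => u - (y - t • k)) ⁻¹' (interior (K : Set Y))ᶜ := by
        ext t; simp [hs]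
      rw [this]
      refine isClosed_Ici.inter (isClosed_biInter fun u _ => ?_)
      exact isOpen_interior.isClosed_compl.preimage (by fun_prop)
    set t := sSup s
    have ht : t ∈ s := hclosed.csSup_mem ⟨0, h0⟩ hbdd
    refine ⟨y - t • k, ⟨fun u hu hlt => ?_, fun w hw => ?_⟩, ?_⟩
    · rcases ext_cases u with rfl | rfl | ⟨u, rfl⟩
      · exact not_ltK_negInf _ hlt
      · exact htop hu
      · exact ht.2 u hu (ltK_fin_fin.1 hlt)
    · rcases ext_cases w with rfl | rfl | ⟨w, rfl⟩
      · exact ⟨_, hu₀, negInf_ltK_fin _⟩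
      · exact (not_posInf_ltK _ hw).elim
      · obtain ⟨ε, hε, hw'⟩ := exists_add_smul_mem_interior_cone (ltK_fin_fin.1 hw) (-k)
        have hnot : t + ε ∉ s := fun hmem => by
          linarith [le_csSup hbdd hmem]
        obtain ⟨u, hu, hlt⟩ : ∃ u, fin u ∈ M ∧
            u - (y - (t + ε) • k) ∈ interior (K : Set Y) := by
          by_contra! hcon
          exact hnot ⟨add_nonneg ht.1 hε.le, hcon⟩
        refine ⟨_, hu, ltK_fin_fin.2 ?_⟩
        have := add_mem_interior_cone hlt (interior_subset hw')
        rwa [show u - (y - (t + ε) • k) + (y - t • k - w + ε • -k) = u - w by module] at this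
    · have h0K := zero_mem_cone hKclosed (interior_subset hk)
      rcases ht.1.eq_or_lt with h | h
      · simpa [← h] using h0K
      · simpa using K.smul_mem h (interior_subset hk)

end WeakSup

/-! ### Epigraphs of conjugates -/

theorem mem_epiK_iff {X Y : Type*} [AddCommGroup Y] [Module ℝ Y] {K : ConvexCone ℝ Y}
    {F : X → WithTop Y} {x : X} {y : Y} :
    (x, y) ∈ epiK K F ↔ ∃ g : Y, F x = g ∧ y - g ∈ K := by
  constructor
  · rintro ⟨k, hk, h⟩
    dsimp only at h
    cases hF : F x with
    | top => simp [hF] at h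
    | coe g =>
      rw [hF, ← WithTop.coe_add, WithTop.coe_inj] at h
      exact ⟨g, rfl, by simpa [h] using hk⟩
  · rintro ⟨g, hg, hk⟩
    refine ⟨y - g, hk, ?_⟩
    change (y : WithTop Y) = F x + _
    rw [hg, ← WithTop.coe_add, add_sub_cancel]

section Conjugate

variable {X Y : Type*} [AddCommGroup X] [Module ℝ X] [TopologicalSpace X]
  [AddCommGroup Y] [Module ℝ Y] [TopologicalSpace Y] {K : ConvexCone ℝ Y}

/-- The epigraph of the conjugate of `F`, described through the epigraph of `F`. -/
theorem mem_epiSet_conj_iff [IsTopologicalAddGroup Y] [ContinuousSMul ℝ Y]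
    (hKclosed : IsClosed (K : Set Y))
    (hKint : (interior (K : Set Y)).Nonempty) {F : X → WithTop Y} (hF : (effDom F).Nonempty)
    {L : X →L[ℝ] Y} {y : Y} :
    fin y ∈ conj K F L + fin '' (K : Set Y) ↔
      ∀ x y', (x, y') ∈ epiK K F → L x - y' - y ∉ interior (K : Set Y) := by
  have hfin : ∀ x (g : Y), F x = g → fin (L x) + extNeg (F x) = fin (L x - g) := by
    intro x g hg
    rw [hg, fin_add_extNeg_coe]
  obtain ⟨x₀, hx₀⟩ := hF
  obtain ⟨g₀, hg₀⟩ := WithTop.ne_top_iff_exists.1 hx₀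
  have hu₀ : fin (L x₀ - g₀) ∈ Set.range fun x => fin (L x) + extNeg (F x) :=
    ⟨x₀, hfin _ _ hg₀.symm⟩
  have htop : posInf ∉ Set.range fun x => fin (L x) + extNeg (F x) := by
    rintro ⟨x, hx⟩
    dsimp only at hx
    cases hF : F x with
    | top =>
      rw [hF, fin_add_extNeg_top] at hx
      exact posInf_ne_negInf hx.symm
    | coe g => exact fin_ne_posInf _ (hfin x g hF ▸ hx)
  rw [conj, fin_mem_wSup_add_iff hKclosed hKint hu₀ htop]
  constructor
  · intro h x y' hxy hint
    obtain ⟨g, hg, hk⟩ := mem_epiK_iff.1 hxy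
    refine h (L x - g) ⟨x, hfin x g hg⟩ ?_
    have := add_mem_interior_cone hint hk
    rwa [show L x - y' - y + (y' - g) = L x - g - y by abel] at this
  · rintro h u ⟨x, hx⟩ hint
    dsimp only at hx
    cases hF : F x with
    | top =>
      rw [hF, fin_add_extNeg_top] at hx
      exact fin_ne_negInf _ hx.symm
    | coe g =>
      have hu := fin_injective ((hfin x g hF).symm.trans hx)
      refine h x g (mem_epiK_iff.2 ⟨g, hF, ?_⟩) (hu ▸ hint)
      simpa using zero_mem_cone hKclosed (interior_subset hKint.some_mem)

end Conjugate

/-! ### Separating and minorizing functionals -/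

section Functionals

/-- A convex set that misses the interior of `K` is separated from it by a continuous functional
which is positive on the interior of `K`. -/
theorem exists_pos_functional {Y : Type*} [AddCommGroup Y] [Module ℝ Y] [TopologicalSpace Y]
    [IsTopologicalAddGroup Y] [ContinuousSMul ℝ Y] {K : ConvexCone ℝ Y} {k : Y}
    (hk : k ∈ interior (K : Set Y)) {A : Set Y} (hA : Convex ℝ A) (hAne : A.Nonempty)
    (hdisj : ∀ a ∈ A, a ∉ interior (K : Set Y)) :
    ∃ f : Y →L[ℝ] ℝ, f k = 1 ∧ (∀ a ∈ interior (K : Set Y), 0 < f a) ∧ ∀ a ∈ A, f a ≤ 0 := by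
  obtain ⟨f, u, hf, hu⟩ := geometric_hahn_banach_open K.convex.interior isOpen_interior hA
    (Set.disjoint_right.2 hdisj)
  have hu0 : 0 ≤ u := by
    have hc : Filter.Tendsto (fun t : ℝ => t * f k) (𝓝[>] 0) (𝓝 0) := by
      have : Continuous fun t : ℝ => t * f k := by fun_prop
      simpa using (this.tendsto 0).mono_left nhdsWithin_le_nhds
    refine le_of_tendsto hc ?_
    filter_upwards [self_mem_nhdsWithin] with t ht
    simpa using (hf _ (smul_mem_interior_cone ht hk)).le
  have hnonpos : ∀ a ∈ interior (K : Set Y), f a ≤ 0 := by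
    intro a ha
    by_contra! hpos
    have := hf _ (smul_mem_interior_cone (t := (u + 1) / f a) (by positivity) ha)
    rw [map_smul, smul_eq_mul, div_mul_cancel₀ _ hpos.ne'] at this
    linarith
  obtain ⟨b, hb⟩ := hAne
  have hneg : ∀ a ∈ interior (K : Set Y), f a < 0 := by
    intro a ha
    refine (hnonpos a ha).lt_of_ne fun h0 => ?_
    -- Otherwise `f a = 0`, and a small step from `a` along `b - a` makes `f` positive.
    obtain ⟨ε, hε, h⟩ := exists_add_smul_mem_interior_cone ha (b - a)
    have h1 := hnonpos _ h
    have h2 := hf a ha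
    have h3 := hu b hb
    rw [map_add, map_smul, map_sub, h0, smul_eq_mul] at h1
    nlinarith
  have hfk := hneg k hk
  refine ⟨(f k)⁻¹ • f, by simp [hfk.ne], fun a ha => ?_, fun a ha => ?_⟩
  · simpa using mul_pos_of_neg_of_neg (inv_lt_zero.2 hfk) (hneg a ha)
  · simpa using mul_nonpos_of_nonpos_of_nonneg (inv_lt_zero.2 hfk).le (hu0.trans (hu a ha))

/-- An algebraic subgradient at `0`: a convex set `C ⊆ E × ℝ` that lies in `r ≥ 0` above the origin
and whose projection on `E` absorbs `E` lies above the graph of a linear functional. This is the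
Riesz extension theorem for the cone generated by `C`. -/
theorem exists_linear_minorant {E : Type*} [AddCommGroup E] [Module ℝ E] {C : Set (E × ℝ)}
    (hC : Convex ℝ C) (h0 : ∀ r, ((0 : E), r) ∈ C → 0 ≤ r)
    (habs : ∀ z : E, ∃ t > (0 : ℝ), ∃ r, (t • z, r) ∈ C) :
    ∃ l : E →ₗ[ℝ] ℝ, ∀ z r, (z, r) ∈ C → l z ≤ r := by
  let D : ConvexCone ℝ (E × ℝ) :=
    { carrier := insert 0 (ConvexCone.hull ℝ C : Set (E × ℝ))
      smul_mem' := by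
        rintro c hc x (rfl | hx)
        · exact .inl (smul_zero c)
        · exact .inr ((ConvexCone.hull ℝ C).smul_mem hc hx)
      add_mem' := by
        rintro x (rfl | hx) y (rfl | hy)
        · exact .inl (add_zero 0)
        · exact .inr (by simpa using hy)
        · exact .inr (by simpa using hx)
        · exact .inr ((ConvexCone.hull ℝ C).add_mem hx hy) }
  have hD0 : D.Pointed := Set.mem_insert _ _
  have hDC : ∀ p ∈ C, p ∈ D := fun p hp => .inr (ConvexCone.subset_hull hp)
  let f : (E × ℝ) →ₗ.[ℝ] ℝ :=
    { domain := LinearMap.ker (LinearMap.fst ℝ E ℝ)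
      toFun := (LinearMap.snd ℝ E ℝ).comp (Submodule.subtype _) }
  obtain ⟨g, hg, hgD⟩ := riesz_extension (D.toPointedCone hD0) f (by
      rintro ⟨⟨z, r⟩, hz : z = 0⟩ hmem
      subst hz
      change 0 ≤ r
      rcases hmem with h | h
      · exact (congrArg Prod.snd h).ge
      · obtain ⟨c, hc, ⟨z, s⟩, hs, hcs⟩ := (ConvexCone.mem_hull_of_convex hC).1 h
        obtain ⟨h1, rfl⟩ := Prod.mk.inj hcs
        obtain rfl : z = 0 := by simpa [hc.ne'] using h1
        exact mul_nonneg hc.le (h0 s hs)) (by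
      rintro ⟨z, r⟩
      obtain ⟨t, ht, s, hs⟩ := habs z
      refine ⟨⟨(0, t⁻¹ * s - r), rfl⟩, .inr ((ConvexCone.mem_hull_of_convex hC).2
        ⟨t⁻¹, inv_pos.2 ht, _, hs, ?_⟩)⟩
      simp [smul_smul, ht.ne'])
  refine ⟨-(g.comp (LinearMap.inl ℝ E ℝ)), fun z r hzr => ?_⟩
  have h1 : 0 ≤ g (z, r) := hgD _ (hDC _ hzr)
  have h2 : g (0, r) = r := hg ⟨(0, r), rfl⟩
  have h3 : g (z, r) = g (z, 0) + g (0, r) := by rw [← map_add]; simp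
  simp only [LinearMap.neg_apply, LinearMap.comp_apply, LinearMap.inl_apply]
  linarith

theorem continuous_of_eventually_le {E : Type*} [AddCommGroup E] [Module ℝ E] [TopologicalSpace E]
    [IsTopologicalAddGroup E] [ContinuousSMul ℝ E] (l : E →ₗ[ℝ] ℝ) {c : ℝ}
    (hl : ∀ᶠ z in 𝓝 (0 : E), l z ≤ c) : Continuous l := by
  obtain ⟨V, hV, hVo, h0⟩ := mem_nhds_iff.1 hl
  by_cases hzero : ∀ x, l x = 0
  · rw [show l = 0 from LinearMap.ext hzero]
    exact continuous_const
  push Not at hzero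
  obtain ⟨x, hx⟩ := hzero
  -- `l` is positive on the translate `a - V`, where `l a = c + 1`.
  set a := ((c + 1) / l x) • x
  have ha : l a = c + 1 := by simp [a, hx]
  refine l.continuous_of_nonzero_on_open ((fun z => a - z) ⁻¹' V) (hVo.preimage (by fun_prop))
    ⟨a, by simpa using h0⟩ fun z hz => ?_
  have := hV hz
  simp only [Set.mem_ofPred_eq, map_sub, ha] at this
  linarith

end Functionals

/-! ### An open mapping theorem for closed convex relations -/

section OpenMapping

/-- In a barrelled space, closed convex absorbing sets are neighbourhoods of the origin. -/
theorem mem_nhds_zero_of_barrelled {E : Type*} [AddCommGroup E] [Module ℝ E] [TopologicalSpace E]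
    [IsTopologicalAddGroup E] [ContinuousSMul ℝ E] [BarrelledSpace ℝ E] {s : Set E}
    (hconv : Convex ℝ s) (hclosed : IsClosed s) (h0 : (0 : E) ∈ s)
    (habs : ∀ z : E, ∃ t > (0 : ℝ), t • z ∈ s) : s ∈ 𝓝 (0 : E) := by
  -- Symmetrize `s` to a barrel, and use that its gauge is lower semicontinuous.
  set B := s ∩ -s with hB
  have hBconv : Convex ℝ B := hconv.inter hconv.neg
  have hB0 : (0 : E) ∈ B := ⟨h0, by simpa using h0⟩
  have hBclosed : IsClosed B := hclosed.inter hclosed.neg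
  have hBbal : Balanced ℝ B := (balanced_iff_neg_mem hBconv).2 fun x hx =>
    ⟨hx.2, by simpa using hx.1⟩
  have hscale : ∀ {z : E} {t r : ℝ}, t • z ∈ s → 0 ≤ r → r ≤ t → 0 < t → r • z ∈ s := by
    intro z t r hz hr hrt ht
    have := hconv.smul_mem_of_zero_mem h0 hz
      (t := r / t) ⟨div_nonneg hr ht.le, (div_le_one ht).2 hrt⟩
    rwa [smul_smul, div_mul_cancel₀ _ ht.ne'] at this
  have hBabs : Absorbent ℝ B := by
    rw [absorbent_iff_eventually_nhdsNE_zero]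
    intro z
    obtain ⟨t₁, ht₁, h₁⟩ := habs z
    obtain ⟨t₂, ht₂, h₂⟩ := habs (-z)
    have ht := lt_min ht₁ ht₂
    have hmem : min t₁ t₂ • z ∈ B := by
      refine ⟨hscale h₁ ht.le (min_le_left _ _) ht₁, ?_⟩
      rw [Set.mem_neg, ← smul_neg]
      exact hscale h₂ ht.le (min_le_right _ _) ht₂
    filter_upwards [nhdsWithin_le_nhds (Metric.ball_mem_nhds (0 : ℝ) ht)] with c hc
    rw [mem_ball_zero_iff] at hc
    have := hBbal.smul_mem (a := c / min t₁ t₂) (by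
      rw [norm_div, Real.norm_of_nonneg ht.le]
      exact (div_le_one ht).2 hc.le) hmem
    rwa [smul_smul, div_mul_cancel₀ _ ht.ne'] at this
  let p : Seminorm ℝ E := gaugeSeminorm hBbal hBconv hBabs
  have hp : Continuous p := by
    refine p.continuous_of_lowerSemicontinuous ?_
    rw [lowerSemicontinuous_iff_isClosed_preimage]
    intro a
    rcases lt_or_ge a 0 with ha | ha
    · convert isClosed_empty
      exact Set.eq_empty_of_forall_notMem fun x hx => (ha.trans_le (apply_nonneg p x)).not_ge hx
    · change IsClosed {x | gauge B x ≤ a}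
      rw [setOfPred_gauge_le_eq hBconv hB0 hBabs ha]
      exact isClosed_biInter fun r hr => hBclosed.smul_of_ne_zero (ha.trans_lt hr).ne'
  have hball : {x | p x < 1} ∈ 𝓝 (0 : E) :=
    (isOpen_lt hp continuous_const).mem_nhds (by simp)
  filter_upwards [hball] with x hx
  exact (setOfPred_gauge_lt_one_subset_self hBconv hB0 hBabs hx).1

/-- Finite sums along a base with `u (n + 1) + u (n + 1) ⊆ u n` telescope: terms in
`u (m + 1), u (m + 2), …` add up to an element of `u m`. -/
theorem sum_range_mem_of_add_subset {W : Type*} [AddCommGroup W] {u : ℕ → Set W}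
    (h0 : ∀ n, (0 : W) ∈ u n) (hadd : ∀ n, u (n + 1) + u (n + 1) ⊆ u n) :
    ∀ (j m : ℕ) (d : ℕ → W), (∀ k, d k ∈ u (m + k + 1)) → ∑ k ∈ Finset.range j, d k ∈ u m := by
  intro j
  induction j with
  | zero => intro m d _; simpa using h0 m
  | succ j ih =>
    intro m d hd
    rw [Finset.sum_range_succ']
    refine hadd m (Set.add_mem_add (ih (m + 1) (fun k => d (k + 1)) fun k => ?_) (hd 0))
    simpa [add_assoc, add_comm, add_left_comm] using hd (k + 1)

/-- If `G ⊆ W × E` is convex with `(0, 0) ∈ G`, the domain `W` is locally convex, and the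
projection of `G` absorbs the barrelled space `E`, then neighbourhoods of `0` in `W` are mapped
by `G` onto sets whose closure is a neighbourhood of `0`. -/
theorem closure_image_mem_nhds_zero {W E : Type*} [AddCommGroup W] [Module ℝ W]
    [TopologicalSpace W] [IsTopologicalAddGroup W] [ContinuousSMul ℝ W] [AddCommGroup E]
    [Module ℝ E] [TopologicalSpace E] [IsTopologicalAddGroup E] [ContinuousSMul ℝ E]
    [BarrelledSpace ℝ E] {G : Set (W × E)} (hconv : Convex ℝ G) (h0 : (0 : W × E) ∈ G)
    (habs : ∀ z : E, ∃ t > (0 : ℝ), ∃ w, (w, t • z) ∈ G) {C : Set W} (hC : Convex ℝ C)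
    (hC0 : C ∈ 𝓝 (0 : W)) : closure (Prod.snd '' (G ∩ Prod.fst ⁻¹' C)) ∈ 𝓝 (0 : E) := by
  have hc : Convex ℝ (Prod.snd '' (G ∩ Prod.fst ⁻¹' C)) :=
    (hconv.inter (hC.linear_preimage (LinearMap.fst ℝ W E))).linear_image (LinearMap.snd ℝ W E)
  refine mem_nhds_zero_of_barrelled hc.closure isClosed_closure
    (subset_closure ⟨0, ⟨h0, show (0 : W) ∈ C from mem_of_mem_nhds hC0⟩, rfl⟩) fun z => ?_
  obtain ⟨t, ht, w, hw⟩ := habs z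
  have hlim : Filter.Tendsto (fun r : ℝ => r • w) (𝓝[>] 0) (𝓝 0) := by
    have : Continuous fun r : ℝ => r • w := by fun_prop
    simpa using (this.tendsto 0).mono_left nhdsWithin_le_nhds
  obtain ⟨r, ⟨hrw, hr1⟩, hr0⟩ := (((hlim.eventually hC0).and
    (nhdsWithin_le_nhds (Iic_mem_nhds one_pos))).and self_mem_nhdsWithin).exists
  refine ⟨r * t, mul_pos hr0 ht, subset_closure ⟨(r • w, (r * t) • z), ⟨?_, hrw⟩, rfl⟩⟩
  have := hconv.smul_mem_of_zero_mem h0 hw ⟨le_of_lt hr0, hr1⟩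
  simpa [smul_smul] using this

/-- **Open mapping theorem for closed convex relations** (Ursescu, Robinson). Let `W` be a complete
first countable locally convex space, `E` barrelled, and `G ⊆ W × E` closed and convex with
`(0, 0) ∈ G`. If the projection of `G` absorbs `E`, then `G` maps neighbourhoods of `0` in `W`
onto neighbourhoods of `0` in `E`.

A preimage of `z` is the sum of a series whose partial sums, completed by a small element
of `G`, lie in `G` by convexity. Since `E` need not be first countable, that element is chosen
only when `G` is shown to meet a prescribed neighbourhood of the limit. -/
theorem eventually_exists_mem_of_barrelled {W E : Type*} [AddCommGroup W] [Module ℝ W]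
    [UniformSpace W] [IsUniformAddGroup W] [ContinuousSMul ℝ W] [LocallyConvexSpace ℝ W]
    [CompleteSpace W] [FirstCountableTopology W] [AddCommGroup E] [Module ℝ E]
    [TopologicalSpace E] [IsTopologicalAddGroup E] [ContinuousSMul ℝ E] [BarrelledSpace ℝ E]
    {G : Set (W × E)} (hconv : Convex ℝ G) (hclosed : IsClosed G) (h0 : (0 : W × E) ∈ G)
    (habs : ∀ z : E, ∃ t > (0 : ℝ), ∃ w, (w, t • z) ∈ G) {U : Set W} (hU : U ∈ 𝓝 (0 : W)) :
    ∀ᶠ z in 𝓝 (0 : E), ∃ w ∈ U, (w, z) ∈ G := by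
  obtain ⟨U', hU', hU'closed, hU'U⟩ := exists_mem_nhds_isClosed_subset hU
  obtain ⟨u, hu, hadd⟩ := IsTopologicalAddGroup.exists_antitone_basis_nhds_zero W
  have hu0 : ∀ n, (0 : W) ∈ u n := fun n => mem_of_mem_nhds (hu.1.mem_of_mem trivial)
  obtain ⟨i, -, hi⟩ := hu.1.mem_iff.1 hU'
  -- The shift by `i` keeps the whole series below in `u i ⊆ U'`.
  have hCex : ∀ k, ∃ C : Set W, Convex ℝ C ∧ C ∈ 𝓝 (0 : W) ∧ C ⊆ u (i + k + 1) := by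
    intro k
    obtain ⟨C, ⟨hC, hCconv⟩, hCu⟩ := (LocallyConvexSpace.convex_basis_zero ℝ W).mem_iff.1
      (hu.1.mem_of_mem (i := i + k + 1) trivial)
    exact ⟨C, hCconv, hC, hCu⟩
  choose C hCconv hC0 hCu using hCex
  set R : ℕ → Set E := fun n => closure (Prod.snd '' (G ∩ Prod.fst ⁻¹' C n))
  have hR : ∀ n, R n ∈ 𝓝 (0 : E) := fun n =>
    closure_image_mem_nhds_zero hconv h0 habs (hCconv n) (hC0 n)
  -- Halving step: a point of `R n` is a value of `G` up to half a point of `R (n + 1)`.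
  have hstep : ∀ n z, z ∈ R n →
      ∃ p ∈ G, p.1 ∈ C n ∧ ∃ z' ∈ R (n + 1), z = p.2 + (2⁻¹ : ℝ) • z' := by
    intro n z hz
    have hnhds : (fun e => (2 : ℝ) • (z - e)) ⁻¹' R (n + 1) ∈ 𝓝 z := by
      have : Continuous fun e : E => (2 : ℝ) • (z - e) := by fun_prop
      refine this.continuousAt.preimage_mem_nhds ?_
      simpa using hR (n + 1)
    obtain ⟨_, he, p, ⟨hpG, hpC⟩, rfl⟩ := mem_closure_iff_nhds.1 hz _ hnhds
    exact ⟨p, hpG, hpC, _, he, by simp [smul_smul]⟩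
  choose! f hfG hfC g hg hfg using hstep
  have hhalf : ∀ᶠ z in 𝓝 (0 : E), (2 : ℝ) • z ∈ R 0 := by
    have : Continuous fun z : E => (2 : ℝ) • z := by fun_prop
    exact this.continuousAt.preimage_mem_nhds (by simpa using hR 0)
  filter_upwards [hhalf] with z hz
  let ζ : ℕ → E := fun n => Nat.rec ((2 : ℝ) • z) (fun n e => g n e) n
  have hζ : ∀ n, ζ n ∈ R n := by
    intro n
    induction n with
    | zero => exact hz
    | succ n ih => exact hg n _ ih
  set p : ℕ → W × E := fun n => f n (ζ n)
  have hpG : ∀ n, p n ∈ G := fun n => hfG n _ (hζ n)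
  have hpC : ∀ n, (p n).1 ∈ C n := fun n => hfC n _ (hζ n)
  have hpζ : ∀ n, ζ n = (p n).2 + (2⁻¹ : ℝ) • ζ (n + 1) := fun n => hfg n _ (hζ n)
  let P : ℕ → W × E := fun n => ∑ k ∈ Finset.range n, (2⁻¹ : ℝ) ^ (k + 1) • p k
  have hP : ∀ n, P (n + 1) = P n + (2⁻¹ : ℝ) ^ (n + 1) • p n := fun n =>
    Finset.sum_range_succ _ n
  -- The weights of `P n` add up to `1 - 2⁻¹ ^ n`, which leaves room for one more point of `G`.
  have hPG : ∀ n, ∀ q ∈ G, P n + (2⁻¹ : ℝ) ^ n • q ∈ G := by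
    intro n
    induction n with
    | zero => intro q hq; simpa [P] using hq
    | succ n ih =>
      intro q hq
      have := ih _ (hconv (hpG n) hq (a := 2⁻¹) (b := 2⁻¹) (by norm_num) (by norm_num)
        (by norm_num))
      rw [hP]
      convert this using 1
      rw [smul_add, smul_smul, smul_smul, ← pow_succ, add_assoc]
  have hPζ : ∀ n, z = (P n).2 + (2⁻¹ : ℝ) ^ (n + 1) • ζ n := by
    intro n
    induction n with
    | zero => simp [P, ζ, smul_smul]
    | succ n ih =>
      rw [hP, ih, hpζ n]
      simp only [Prod.snd_add, Prod.smul_snd, smul_add, smul_smul, add_assoc, ← pow_succ]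
  have hCsmul : ∀ n, ∀ w ∈ C n, (2⁻¹ : ℝ) ^ (n + 1) • w ∈ u (i + n + 1) := fun n w hw =>
    hCu n <| (hCconv n).smul_mem_of_zero_mem (mem_of_mem_nhds (hC0 n)) hw
      ⟨by positivity, pow_le_one₀ (by norm_num) (by norm_num)⟩
  have hP1 : ∀ n, (P n).1 = ∑ k ∈ Finset.range n, (2⁻¹ : ℝ) ^ (k + 1) • (p k).1 := by
    intro n
    simp [P, Prod.fst_sum]
  have hcauchy : CauchySeq fun n => (P n).1 := by
    have hb := hu.1.comap fun x : W × W => x.1 - x.2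
    rw [← uniformity_eq_comap_nhds_zero_swapped] at hb
    refine hb.cauchySeq_iff'.2 fun N _ => ⟨N, fun n hn => ?_⟩
    obtain ⟨j, rfl⟩ := Nat.exists_eq_add_of_le hn
    change (P (N + j)).1 - (P N).1 ∈ u N
    rw [hP1, hP1, Finset.sum_range_add, add_sub_cancel_left]
    refine hu.2 (Nat.le_add_left N i) (sum_range_mem_of_add_subset hu0 hadd j (i + N) _ ?_)
    intro k
    have := hCsmul (N + k) _ (hpC (N + k))
    rwa [← add_assoc] at this
  obtain ⟨w, hw⟩ := cauchySeq_tendsto_of_complete hcauchy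
  refine ⟨w, hU'U (hU'closed.mem_of_tendsto hw (.of_forall fun n => hi ?_)), ?_⟩
  · rw [hP1]
    exact sum_range_mem_of_add_subset hu0 hadd n i _ fun k => hCsmul k _ (hpC k)
  · rw [← hclosed.closure_eq, mem_closure_iff_nhds]
    intro N hN
    obtain ⟨A, hA, B, hB, hAB⟩ := mem_nhds_prod_iff.1 hN
    have hAadd : ∀ᶠ q : W × W in 𝓝 w ×ˢ 𝓝 0, q.1 + q.2 ∈ A := by
      have : Continuous fun q : W × W => q.1 + q.2 := by fun_prop
      rw [← nhds_prod_eq]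
      exact this.continuousAt.preimage_mem_nhds (by simpa using hA)
    obtain ⟨A₁, hA₁, A₂, hA₂, hA₁₂⟩ := Filter.eventually_prod_iff.1 hAadd
    obtain ⟨m, -, hm⟩ := hu.1.mem_iff.1 hA₂
    obtain ⟨n, hnA, hnm⟩ := ((hw.eventually hA₁).and (Filter.eventually_ge_atTop m)).exists
    have hB' : (fun e => (P n).2 + (2⁻¹ : ℝ) ^ (n + 1) • e) ⁻¹' B ∈ 𝓝 (ζ n) := by
      have : Continuous fun e : E => (P n).2 + (2⁻¹ : ℝ) ^ (n + 1) • e := by fun_prop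
      refine this.continuousAt.preimage_mem_nhds ?_
      rwa [← hPζ n]
    -- Replace the remainder `ζ n` by a genuine value `q.2` of `G` close to it.
    obtain ⟨_, he, q, ⟨hqG, hqC⟩, rfl⟩ := mem_closure_iff_nhds.1 (hζ n) _ hB'
    refine ⟨P n + (2⁻¹ : ℝ) ^ (n + 1) • q, hAB ⟨?_, he⟩, ?_⟩
    · refine hA₁₂ hnA (hm ?_)
      exact hu.2 (by omega) (hCsmul n _ hqC)
    -- `hPG` allows the weight `2⁻¹ ^ n`; half of it goes to the origin, which lies in `G`.
    · have hq2 : (2⁻¹ : ℝ) • q ∈ G := hconv.smul_mem_of_zero_mem h0 hqG (by norm_num)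
      have := hPG n _ hq2
      rwa [smul_smul, ← pow_succ] at this

end OpenMapping

/-! ### Regularity conditions -/

section Regularity

theorem intrinsicInterior_subset_intrinsicCore {E : Type*} [AddCommGroup E] [Module ℝ E]
    [TopologicalSpace E] [IsTopologicalAddGroup E] [ContinuousSMul ℝ E] (U : Set E) :
    intrinsicInterior ℝ U ⊆ intrinsicCore U := by
  rintro _ ⟨x, hx, rfl⟩
  have hxU : x ∈ ((↑) ⁻¹' U : Set (affineSpan ℝ U)) := interior_subset hx
  refine ⟨hxU, fun x' hx' => ?_⟩
  let γ : ℝ → affineSpan ℝ U := fun t =>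
    ⟨AffineMap.lineMap (x : E) x' t, AffineMap.lineMap_mem t x.2 hx'⟩
  have hγt : ∀ t, (γ t : E) = x + t • (x' - x) := fun t => by
    simp [γ, AffineMap.lineMap_apply_module', add_comm]
  have hγ : Continuous γ := by
    rw [Topology.IsInducing.subtypeVal.continuous_iff]
    exact (by fun_prop : Continuous fun t : ℝ => (x : E) + t • (x' - x)).congr fun t => (hγt t).symm
  have hev : γ ⁻¹' ((↑) ⁻¹' U) ∈ 𝓝 (0 : ℝ) := by
    refine hγ.continuousAt.preimage_mem_nhds ?_
    rw [show γ 0 = x from Subtype.ext (by simp [hγt])]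
    exact mem_interior_iff_mem_nhds.1 hx
  obtain ⟨δ, hδ, hball⟩ := Metric.nhds_basis_closedBall.mem_iff.1 hev
  refine ⟨δ, hδ, fun t ht => ?_⟩
  have : γ t ∈ ((↑) ⁻¹' U : Set (affineSpan ℝ U)) := hball (by
    rw [mem_closedBall_zero_iff, Real.norm_of_nonneg ht.1]
    exact ht.2)
  simpa [hγt] using this

theorem exists_smul_mem_projDom {X Y Z : Type*} [AddCommGroup Z] [Module ℝ Z]
    {Φ : X × Z → WithTop Y} (h : (0 : Z) ∈ intrinsicCore (projDom Φ)) (z : Z0 Φ) :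
    ∃ t > (0 : ℝ), t • (z : Z) ∈ projDom Φ := by
  have hz : (z : Z) ∈ affineSpan ℝ (projDom Φ) := by
    rw [← Set.insert_eq_of_mem h.1, ← SetLike.mem_coe, affineSpan_insert_zero]
    exact z.2
  obtain ⟨δ, hδ, hmem⟩ := h.2 z hz
  exact ⟨δ, hδ, by simpa using hmem δ ⟨hδ.le, le_rfl⟩⟩

theorem mem_epiK_of_leK {X Z Y : Type*} [AddCommGroup Y] [Module ℝ Y] {K : ConvexCone ℝ Y}
    {Φ : X × Z → WithTop Y} {x : X} {z : Z} {y : Y} (h : LeK K (Φ (x, z)) y) :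
    ((x, z), y) ∈ epiK K Φ := by
  rcases h with h | ⟨y₁, y₂, h₁, h₂, h⟩
  · exact (WithTop.coe_ne_top h).elim
  · refine mem_epiK_iff.2 ⟨y₁, h₁, ?_⟩
    rw [WithTop.coe_inj.1 h₂]
    simpa using h

/-- Near `0` the values `Φ (x, z)` lie in the neighbourhood `y₀ + k - int K` of `y₀`. -/
theorem C3.toC2 {X Y Z : Type*} [AddCommGroup Y] [Module ℝ Y] [UniformSpace Y]
    [IsUniformAddGroup Y] [AddCommGroup Z] [Module ℝ Z] [TopologicalSpace Z] {K : ConvexCone ℝ Y}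
    {Φ : X × Z → WithTop Y} (hKint : (interior (K : Set Y)).Nonempty) (h : C3 Φ) : C2 K Φ := by
  obtain ⟨k, hk⟩ := hKint
  obtain ⟨x, y₀, -, hlim⟩ := h
  have hnhds : (fun y => y₀ + k - y) ⁻¹' interior (K : Set Y) ∈ 𝓝 y₀ := by
    have : Continuous fun y => y₀ + k - y := by fun_prop
    exact this.continuousAt.preimage_mem_nhds (isOpen_interior.mem_nhds (by simpa using hk))
  obtain ⟨V, hV, hsub⟩ := mem_nhds_subtype _ _ _ |>.1 (hlim (Filter.image_mem_map hnhds))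
  refine ⟨x, y₀ + k, V, hV, fun z hz => .inr ?_⟩
  obtain ⟨y, hy, hyz⟩ := hsub (show (⟨z, hz.2⟩ : Z0 Φ) ∈ Subtype.val ⁻¹' V from hz.1)
  exact ⟨y, y₀ + k, hyz.symm, rfl, by simpa using interior_subset hy⟩

variable {X Y Z : Type*}
  [AddCommGroup X] [Module ℝ X] [UniformSpace X] [IsUniformAddGroup X] [ContinuousSMul ℝ X]
  [AddCommGroup Y] [Module ℝ Y] [UniformSpace Y] [IsUniformAddGroup Y] [ContinuousSMul ℝ Y]
  [AddCommGroup Z] [Module ℝ Z] [TopologicalSpace Z] [IsTopologicalAddGroup Z]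
  [ContinuousSMul ℝ Z] {K : ConvexCone ℝ Y} {Φ : X × Z → WithTop Y}

/-- Under `C5`, every continuous functional on `X × Y` is bounded above along a selection of the
epigraph of `Φ` over some neighbourhood of `0` in `Z₀`. -/
theorem C5.eventually_exists_le [LocallyConvexSpace ℝ X] [LocallyConvexSpace ℝ Y]
    (hconv : Convex ℝ (epiK K Φ)) (h0K : (0 : Y) ∈ K) (h : C5 K Φ) (φ : X × Y →L[ℝ] ℝ) :
    ∃ c, ∀ᶠ z : Z0 Φ in 𝓝 0, ∃ x y, ((x, (z : Z)), y) ∈ epiK K Φ ∧ φ (x, y) ≤ c := by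
  obtain ⟨_, _, _, _, _, hclosed, hcore⟩ := h
  have hproj : ∀ z ∈ projDom Φ, ∃ x y, ((x, z), y) ∈ epiK K Φ := by
    rintro _ ⟨⟨x, z⟩, hxz, rfl⟩
    obtain ⟨g, hg⟩ := WithTop.ne_top_iff_exists.1 hxz
    exact ⟨x, g, mem_epiK_iff.2 ⟨g, hg.symm, by simpa using h0K⟩⟩
  obtain ⟨x₀, y₀, h₀⟩ := hproj 0 hcore.1
  -- The epigraph, translated so that it contains the origin.
  let A : ((X × Y) × Z0 Φ) →ᵃ[ℝ] (X × Z) × Y :=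
    (((LinearMap.fst ℝ X Y ∘ₗ LinearMap.fst ℝ (X × Y) (Z0 Φ)).prod
      ((Z0 Φ).subtype ∘ₗ LinearMap.snd ℝ (X × Y) (Z0 Φ))).prod
      (LinearMap.snd ℝ X Y ∘ₗ LinearMap.fst ℝ (X × Y) (Z0 Φ))).toAffineMap +
      AffineMap.const ℝ _ ((x₀, 0), y₀)
  have hA : ∀ p, A p = ((p.1.1 + x₀, (p.2 : Z)), p.1.2 + y₀) := fun p => by simp [A]
  have hAcont : Continuous A := by
    rw [show (A : _ → _) = fun p => ((p.1.1 + x₀, (p.2 : Z)), p.1.2 + y₀) from funext hA]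
    fun_prop
  have hU : {w : X × Y | φ w ≤ 1} ∈ 𝓝 (0 : X × Y) :=
    φ.continuous.continuousAt.preimage_mem_nhds (Iic_mem_nhds (by simp))
  refine ⟨φ (x₀, y₀) + 1, ?_⟩
  filter_upwards [eventually_exists_mem_of_barrelled (G := A ⁻¹' epiK K Φ)
    (hconv.affine_preimage A) (hclosed.preimage hAcont) (by simpa [hA] using h₀) (fun z => by
      obtain ⟨t, ht, hmem⟩ := exists_smul_mem_projDom hcore z
      obtain ⟨x, y, hxy⟩ := hproj _ hmem
      exact ⟨t, ht, (x - x₀, y - y₀), by simpa [hA] using hxy⟩) hU] with z hz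
  obtain ⟨w, hw, hwG⟩ := hz
  rw [Set.mem_preimage, hA] at hwG
  refine ⟨_, _, hwG, ?_⟩
  have hsum : (w.1 + x₀, w.2 + y₀) = (x₀, y₀) + w := by
    rw [add_comm (x₀, y₀) w]; rfl
  rw [hsum, map_add]
  exact add_le_add le_rfl hw

/-- Scalar duality: a continuous affine functional that is nonnegative on the slice of the
epigraph of `Φ` over `z = 0` is minorized on the whole epigraph by a continuous functional of
`z`. The algebraic functional on `Z₀` is continuous since it is bounded above near `0`, or since
`Z₀` is finite-dimensional. -/
theorem exists_continuous_minorant [LocallyConvexSpace ℝ X] [LocallyConvexSpace ℝ Y]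
    [LocallyConvexSpace ℝ Z] [T2Space Z]
    (hKint : (interior (K : Set Y)).Nonempty) (h0K : (0 : Y) ∈ K)
    (hconv : Convex ℝ (epiK K Φ)) (hC : C2 K Φ ∨ C3 Φ ∨ C4 Φ ∨ C5 K Φ) (φ : X × Y →L[ℝ] ℝ) (c : ℝ)
    (hφ : ∀ x y, ((x, (0 : Z)), y) ∈ epiK K Φ → 0 ≤ φ (x, y) + c) :
    ∃ l : Z →L[ℝ] ℝ, ∀ x z y, ((x, z), y) ∈ epiK K Φ → l z ≤ φ (x, y) + c := by
  set C : Set (Z0 Φ × ℝ) := {p | ∃ x y, ((x, (p.1 : Z)), y) ∈ epiK K Φ ∧ φ (x, y) + c = p.2}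
  have hCconv : Convex ℝ C := by
    rintro ⟨z₁, r₁⟩ ⟨x₁, y₁, h₁, hr₁⟩ ⟨z₂, r₂⟩ ⟨x₂, y₂, h₂, hr₂⟩ a b ha hb hab
    refine ⟨a • x₁ + b • x₂, a • y₁ + b • y₂, hconv h₁ h₂ ha hb hab, ?_⟩
    have : (a • x₁ + b • x₂, a • y₁ + b • y₂) = a • (x₁, y₁) + b • (x₂, y₂) := rfl
    rw [this, map_add, map_smul, map_smul]
    simp only [smul_eq_mul, Prod.smul_mk, Prod.mk_add_mk] at hr₁ hr₂ ⊢
    linear_combination a * hr₁ + b * hr₂ - c * hab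
  have hC0 : ∀ r, ((0 : Z0 Φ), r) ∈ C → 0 ≤ r := by
    rintro r ⟨x, y, h, rfl⟩
    exact hφ x y (by simpa using h)
  -- It suffices to find a continuous functional on `Z₀`.
  suffices h : ∃ l : Z0 Φ →ₗ[ℝ] ℝ, Continuous l ∧ ∀ z r, (z, r) ∈ C → l z ≤ r by
    obtain ⟨l, hl, hlC⟩ := h
    obtain ⟨m, hm⟩ := StrongDual.exists_extension (Z0 Φ) (⟨l, hl⟩ : Z0 Φ →L[ℝ] ℝ)
    refine ⟨m, fun x z y hxzy => ?_⟩
    obtain ⟨g, hg, -⟩ := mem_epiK_iff.1 hxzy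
    have hz : z ∈ Z0 Φ := Submodule.subset_span
      ⟨(x, z), show Φ (x, z) ≠ ⊤ by rw [hg]; exact WithTop.coe_ne_top, rfl⟩
    rw [show z = ((⟨z, hz⟩ : Z0 Φ) : Z) from rfl, hm]
    exact hlC ⟨z, hz⟩ _ ⟨x, y, hxzy, rfl⟩
  have hbounded : (∃ c', ∀ᶠ z : Z0 Φ in 𝓝 0, ∃ x y,
      ((x, (z : Z)), y) ∈ epiK K Φ ∧ φ (x, y) ≤ c') →
      ∃ l : Z0 Φ →ₗ[ℝ] ℝ, Continuous l ∧ ∀ z r, (z, r) ∈ C → l z ≤ r := by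
    rintro ⟨c', hc'⟩
    obtain ⟨l, hl⟩ := exists_linear_minorant hCconv hC0 fun z => by
      have hlim : Filter.Tendsto (fun t : ℝ => t • z) (𝓝[>] 0) (𝓝 0) := by
        have : Continuous fun t : ℝ => t • z := by fun_prop
        simpa using (this.tendsto 0).mono_left nhdsWithin_le_nhds
      obtain ⟨t, ⟨x, y, hxy, -⟩, ht⟩ :=
        ((hlim.eventually hc').and self_mem_nhdsWithin).exists
      exact ⟨t, ht, _, x, y, hxy, rfl⟩
    refine ⟨l, continuous_of_eventually_le l (c := c' + c) ?_, hl⟩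
    filter_upwards [hc'] with z ⟨x, y, hxy, hle⟩
    exact (hl z _ ⟨x, y, hxy, rfl⟩).trans (by simpa using hle)
  have hC2 : C2 K Φ → ∃ l : Z0 Φ →ₗ[ℝ] ℝ, Continuous l ∧ ∀ z r, (z, r) ∈ C → l z ≤ r := by
    rintro ⟨x, y, V, hV, h⟩
    refine hbounded ⟨φ (x, y), ?_⟩
    filter_upwards [preimage_coe_mem_nhds_subtype.2 (mem_nhdsWithin_of_mem_nhds hV)] with z hz
    exact ⟨x, y, mem_epiK_of_leK (h z ⟨hz, z.2⟩), le_rfl⟩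
  rcases hC with h | h | ⟨hfd, hri⟩ | h
  · exact hC2 h
  · exact hC2 (h.toC2 hKint)
  · obtain ⟨l, hl⟩ := exists_linear_minorant hCconv hC0 fun z => by
      obtain ⟨t, ht, ⟨x, z'⟩, hxz, hz'⟩ :=
        exists_smul_mem_projDom (intrinsicInterior_subset_intrinsicCore _ hri) z
      obtain ⟨g, hg⟩ := WithTop.ne_top_iff_exists.1 hxz
      obtain rfl : z' = t • (z : Z) := hz'
      exact ⟨t, ht, _, x, g, mem_epiK_iff.2 ⟨g, hg.symm, by simpa using h0K⟩, rfl⟩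
    exact ⟨l, l.continuous_of_finiteDimensional, hl⟩
  · exact hbounded (h.eventually_exists_le hconv h0K φ)

/-- A point `(L, y)` of the epigraph of the conjugate of `Φ(·, 0)` is certified by a functional
`f` on `Y`, positive on the interior of `K`, together with a functional `l` on `Z`. Under `C6`
the functional `l = 0` will do. -/
theorem exists_functionals [LocallyConvexSpace ℝ X] [LocallyConvexSpace ℝ Y]
    [LocallyConvexSpace ℝ Z] [T2Space Z] {k : Y} (hk : k ∈ interior (K : Set Y))
    (h0K : (0 : Y) ∈ K) (hconv : Convex ℝ (epiK K Φ)) (hzero : (0 : Z) ∈ projDom Φ)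
    (hC : C2 K Φ ∨ C3 Φ ∨ C4 Φ ∨ C5 K Φ ∨ C6 K Φ) {L : X →L[ℝ] Y} {y : Y}
    (hLy : ∀ x y', ((x, (0 : Z)), y') ∈ epiK K Φ → L x - y' - y ∉ interior (K : Set Y)) :
    ∃ (f : Y →L[ℝ] ℝ) (l : Z →L[ℝ] ℝ), f k = 1 ∧ (∀ a ∈ interior (K : Set Y), 0 < f a) ∧
      ∀ x z y', ((x, z), y') ∈ epiK K Φ → f (L x - y' - y) + l z ≤ 0 := by
  have hAconv : Convex ℝ {a | ∃ x y', ((x, (0 : Z)), y') ∈ epiK K Φ ∧ L x - y' - y = a} := by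
    rintro _ ⟨x₁, y₁, h₁, rfl⟩ _ ⟨x₂, y₂, h₂, rfl⟩ a b ha hb hab
    refine ⟨a • x₁ + b • x₂, a • y₁ + b • y₂,
      by simpa using hconv h₁ h₂ ha hb hab, ?_⟩
    obtain rfl : b = 1 - a := by linarith
    rw [map_add, map_smul, map_smul]
    module
  obtain ⟨⟨x₀, z₀⟩, hx₀, hz₀⟩ := hzero
  obtain ⟨g₀, hg₀⟩ := WithTop.ne_top_iff_exists.1 hx₀
  obtain rfl : z₀ = 0 := hz₀
  obtain ⟨f, hfk, hfpos, hf⟩ := exists_pos_functional hk hAconv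
    ⟨_, x₀, g₀, mem_epiK_iff.2 ⟨g₀, hg₀.symm, by simpa using h0K⟩, rfl⟩ (by
      rintro _ ⟨x, y', h, rfl⟩
      exact hLy x y' h)
  have hmain : ∀ x y', ((x, (0 : Z)), y') ∈ epiK K Φ → f (L x - y' - y) ≤ 0 :=
    fun x y' h => hf _ ⟨x, y', h, rfl⟩
  suffices h : ∃ l : Z →L[ℝ] ℝ, ∀ x z y', ((x, z), y') ∈ epiK K Φ →
      f (L x - y' - y) + l z ≤ 0 by
    obtain ⟨l, hl⟩ := h
    exact ⟨f, l, hfk, hfpos, hl⟩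
  by_cases h6 : C6 K Φ
  · refine ⟨0, fun x z y' h => ?_⟩
    obtain ⟨g, hg, hgk⟩ := mem_epiK_iff.1 h
    have hle := h6.1 x z (show Φ (x, z) ≠ ⊤ by rw [hg]; exact WithTop.coe_ne_top)
    rw [hg] at hle
    obtain ⟨g', hg', hgk'⟩ := mem_epiK_iff.1 (mem_epiK_of_leK hle)
    simpa using hmain x y' (mem_epiK_iff.2 ⟨g', hg', by simpa using K.add_mem hgk hgk'⟩)
  · let φ : X × Y →L[ℝ] ℝ :=
      f ∘L (ContinuousLinearMap.snd ℝ X Y - L ∘L ContinuousLinearMap.fst ℝ X Y)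
    have hφ : ∀ x y', φ (x, y') + f y = -f (L x - y' - y) := fun x y' => by
      simp [φ]; ring
    obtain ⟨l, hl⟩ := exists_continuous_minorant ⟨k, hk⟩ h0K hconv (by tauto) φ (f y)
      fun x y' h => by
        rw [hφ]
        linarith [hmain x y' h]
    refine ⟨l, fun x z y' h => ?_⟩
    have := hl x z y' h
    rw [hφ] at this
    linarith

end Regularity

/-! ### Representations of the epigraph -/

section Representation

variable {X Y Z : Type*}
  [AddCommGroup X] [Module ℝ X] [UniformSpace X]
  [AddCommGroup Y] [Module ℝ Y] [UniformSpace Y] [IsUniformAddGroup Y]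
  [AddCommGroup Z] [Module ℝ Z] [TopologicalSpace Z]
  {K : ConvexCone ℝ Y} {S : ConvexCone ℝ Z} {Φ : X × Z → WithTop Y}

theorem mem_setM_iff {p : (X →L[ℝ] Y) × Y} :
    p ∈ setM K Φ ↔
      ∃ T : Z →L[ℝ] Y, fin p.2 ∈ conj K Φ (p.1.coprod T) + fin '' (K : Set Y) := by
  simp only [setM, Set.mem_iUnion, exists_prop]
  refine ⟨fun ⟨T, _, h⟩ => ⟨T, h⟩, fun ⟨T, h⟩ => ⟨T, ⟨p.1, fun heq => ?_⟩, h⟩⟩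
  obtain ⟨v, hv, -⟩ := mem_add_image_fin_iff.1 h
  exact fin_ne_posInf v (by simpa using heq.subset hv)

theorem mem_setMPos_iff {p : (X →L[ℝ] Y) × Y} :
    p ∈ setMPos S K Φ ↔ ∃ T ∈ posOps S K,
      fin p.2 ∈ conj K Φ (p.1.coprod T) + fin '' (K : Set Y) := by
  simp only [setMPos, Set.mem_iUnion, exists_prop]
  refine ⟨fun ⟨T, hT, h⟩ => ⟨T, hT.2, h⟩, fun ⟨T, hT, h⟩ => ⟨T, ⟨⟨p.1, fun heq => ?_⟩, hT⟩, h⟩⟩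
  obtain ⟨v, hv, -⟩ := mem_add_image_fin_iff.1 h
  exact fin_ne_posInf v (by simpa using heq.subset hv)

omit [IsUniformAddGroup Y] in
/-- Under `C0`, the functional on `Z` in a certificate is nonnegative on `S`. -/
theorem nonneg_of_C0 (h0 : C0 S K Φ) {f : Y →L[ℝ] ℝ} {l : Z →L[ℝ] ℝ}
    {L : X →L[ℝ] Y} {y : Y}
    (hl : ∀ x z y', ((x, z), y') ∈ epiK K Φ → f (L x - y' - y) + l z ≤ 0) {s : Z} (hs : s ∈ S) :
    0 ≤ l s := by
  obtain ⟨x, hx, hle⟩ := h0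
  obtain ⟨g, hg⟩ := WithTop.ne_top_iff_exists.1 hx
  by_contra! hneg
  set a := f (L x - g - y)
  -- Moving along `-t • s` with `t` large would make the certificate positive.
  have ht : 0 < (|a| + 1) / -l s := by
    have := neg_pos.2 hneg
    positivity
  have h1 := hl x (-(((|a| + 1) / -l s) • s)) g (mem_epiK_of_leK (by
    rw [hg]
    exact hle _ (by simpa using S.smul_mem ht hs)))
  have h2 : (|a| + 1) / -l s * l s = -(|a| + 1) := by
    field_simp [hneg.ne]
  rw [map_neg, map_smul, smul_eq_mul, h2] at h1
  linarith [neg_abs_le a]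

end Representation

end VectorPerturbation

open VectorPerturbation in
theorem mainTheorem4 {X Y Z : Type*}
    [AddCommGroup X] [Module ℝ X] [UniformSpace X] [IsUniformAddGroup X]
    [ContinuousSMul ℝ X] [LocallyConvexSpace ℝ X] [T2Space X]
    [AddCommGroup Y] [Module ℝ Y] [UniformSpace Y] [IsUniformAddGroup Y]
    [ContinuousSMul ℝ Y] [LocallyConvexSpace ℝ Y] [T2Space Y]
    [AddCommGroup Z] [Module ℝ Z] [TopologicalSpace Z] [IsTopologicalAddGroup Z]
    [ContinuousSMul ℝ Z] [LocallyConvexSpace ℝ Z] [T2Space Z]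
    (K : ConvexCone ℝ Y) (hKproper : (K : Set Y) ≠ Set.univ) (hKclosed : IsClosed (K : Set Y))
    (hKint : (interior (K : Set Y)).Nonempty)
    (S : ConvexCone ℝ Z) (hS : (S : Set Z).Nonempty)
    (Φ : X × Z → WithTop Y)
    (hΦconvex : Convex ℝ (VectorPerturbation.epiK K Φ))
    (hΦzero : (0 : Z) ∈ VectorPerturbation.projDom Φ)
    (hC : VectorPerturbation.C2 K Φ ∨ VectorPerturbation.C3 Φ ∨ VectorPerturbation.C4 Φ ∨
      VectorPerturbation.C5 K Φ ∨ VectorPerturbation.C6 K Φ) :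
    VectorPerturbation.epiSet K (VectorPerturbation.conj K fun x => Φ (x, 0)) =
        VectorPerturbation.setM K Φ ∧
      (VectorPerturbation.C0 S K Φ →
        VectorPerturbation.epiSet K (VectorPerturbation.conj K fun x => Φ (x, 0)) =
            VectorPerturbation.setM K Φ ∧
          VectorPerturbation.setM K Φ = VectorPerturbation.setMPos S K Φ) := by
  obtain ⟨k, hk⟩ := id hKint
  have h0K := zero_mem_cone hKclosed (interior_subset hk)
  have hslice : ∀ x y, (x, y) ∈ epiK K (fun x => Φ (x, 0)) ↔ ((x, (0 : Z)), y) ∈ epiK K Φ :=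
    fun x y => by rw [mem_epiK_iff, mem_epiK_iff]
  have hdom : (effDom fun x => Φ (x, 0)).Nonempty := by
    obtain ⟨⟨x, z⟩, hx, hz⟩ := hΦzero
    obtain rfl : z = 0 := hz
    exact ⟨x, hx⟩
  have hdom' : (effDom Φ).Nonempty := hΦzero.imp fun _ h => h.1
  have hsub : setM K Φ ⊆ epiSet K (conj K fun x => Φ (x, 0)) := by
    rintro ⟨L, y⟩ h
    obtain ⟨T, hT⟩ := mem_setM_iff.1 h
    rw [mem_epiSet_conj_iff hKclosed hKint hdom'] at hT
    refine (mem_epiSet_conj_iff hKclosed hKint hdom).2 fun x y' hxy => ?_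
    simpa using hT (x, 0) y' ((hslice x y').1 hxy)
  -- The rank-one operator `z ↦ l z • k` exhibits a point of the epigraph as a point of `𝓜`.
  have hex : ∀ L y, (L, y) ∈ epiSet K (conj K fun x => Φ (x, 0)) →
      ∃ T : Z →L[ℝ] Y, fin y ∈ conj K Φ (L.coprod T) + fin '' (K : Set Y) ∧
        (C0 S K Φ → T ∈ posOps S K) := by
    intro L y h
    have hLy := (mem_epiSet_conj_iff hKclosed hKint hdom).1 h
    obtain ⟨f, l, hfk, hfpos, hl⟩ := exists_functionals hk h0K hΦconvex hΦzero hC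
      fun x y' hxy => hLy x y' ((hslice x y').2 hxy)
    refine ⟨l.smulRight k, (mem_epiSet_conj_iff hKclosed hKint hdom').2 ?_, fun h0 s hs => ?_⟩
    · rintro ⟨x, z⟩ y' hxz hint
      have h1 := hfpos _ hint
      have h2 := hl x z y' hxz
      have h3 : f (L.coprod (l.smulRight k) (x, z) - y' - y) = f (L x - y' - y) + l z := by
        simp [hfk]; ring
      linarith
    · rcases (nonneg_of_C0 h0 hl hs).eq_or_lt with h | h
      · simpa [← h] using h0K
      · simpa using K.smul_mem h (interior_subset hk)
  have heq : epiSet K (conj K fun x => Φ (x, 0)) = setM K Φ :=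
    Set.Subset.antisymm (fun p hp => by
      obtain ⟨T, hT, -⟩ := hex p.1 p.2 hp
      exact mem_setM_iff.2 ⟨T, hT⟩) hsub
  refine ⟨heq, fun h0 => ⟨heq, Set.Subset.antisymm (fun p hp => ?_) fun p hp => ?_⟩⟩
  · obtain ⟨T, hT, hpos⟩ := hex p.1 p.2 (hsub hp)
    exact mem_setMPos_iff.2 ⟨T, hpos h0, hT⟩
  · obtain ⟨T, -, hT⟩ := mem_setMPos_iff.1 hp
    exact mem_setM_iff.2 ⟨T, hT⟩
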